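/- Let $\mathbb{K}$ be a field of characteristic zero, and let $m,n\ge 1$ be integers with $m+n\le 5$. Let $K_{m,n}$ be the complete bipartite graph, with edges $1,\dots,N$ where $N=mn$, and let $$F=\sum_{T}\prod_{e\in E(T)}x_e\in\mathbb{K}[x_1,\dots,x_N]$$ be its Kirchhoff polynomial, where $T$ runs over the spanning trees of $K_{m,n}$. Put $$\operatorname{Ann}(F)=\Big\{P\in\mathbb{K}[x_1,\dots,x_N] : P\Big(\tfrac{\partial}{\partial x_1},\dots,\tfrac{\partial}{\partial x_N}\Big)F=0\Big\},\qquad A_{M(K_{m,n})}=\mathbb{K}[x_1,\dots,x_N]/\operatorname{Ann}(F),$$ where the homogeneous component of degree $k$ of $A_{M(K_{m,n})}$ is the set of classes of the homogeneous polynomials of degree $k$. A graded Artinian algebra $A=\bigoplus_{k=0}^{s}A_k$ with $A_s\neq 0$ is said to have the strong Lefschetz property if there is an element $L\in A_1$ such that the multiplication map $\times L^{s-2k}\colon A_k\to A_{s-k}$ is bijective for all integers $0\le k\le s/2$; such an $L$ is called a strong Lefschetz element. Then $A_{M(K_{m,n})}$ is a graded Artinian algebra which has the strong Lefschetz property, and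 (the class of) $x_1+\cdots+x_N$ is a strong Lefschetz element of it. -/

import Mathlib

open MvPolynomial

noncomputable section

/-- The partial derivatives `∂/∂x_i` and `∂/∂x_j` commute as linear operators. -/
theorem pderiv_comp_comm {σ K : Type*} [Field K] (i j : σ) :
    (pderiv i : Derivation K (MvPolynomial σ K) (MvPolynomial σ K)).toLinearMap *
        (pderiv j : Derivation K (MvPolynomial σ K) (MvPolynomial σ K)).toLinearMap =
      (pderiv j : Derivation K (MvPolynomial σ K) (MvPolynomial σ K)).toLinearMap *
        (pderiv i : Derivation K (MvPolynomial σ K) (MvPolynomial σ K)).toLinearMap := by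
  classical
  have h : ⁅(pderiv i : Derivation K (MvPolynomial σ K) (MvPolynomial σ K)),
      (pderiv j : Derivation K (MvPolynomial σ K) (MvPolynomial σ K))⁆ = 0 := by
    apply MvPolynomial.derivation_ext
    intro k
    by_cases hi : i = k <;> by_cases hj : j = k <;>
      simp [Derivation.commutator_apply, pderiv_X, hi, hj]
  refine LinearMap.ext fun p => ?_
  have := DFunLike.congr_fun h p
  rw [Derivation.commutator_apply] at this
  exact sub_eq_zero.mp this

open scoped IsMulCommutative in
/-- The substitution `P ↦ P(∂/∂x_i : i ∈ σ)`, as the `K`-algebra homomorphism from `K[x_i : i ∈ σ]`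
to the linear operators on `K[x_i : i ∈ σ]` which sends `x_i` to `∂/∂x_i` (see `diffOp_X`). -/
def diffOp (σ K : Type*) [Field K] :
    MvPolynomial σ K →ₐ[K] Module.End K (MvPolynomial σ K) :=
  let D : σ → Module.End K (MvPolynomial σ K) := fun i => (pderiv i).toLinearMap
  let S : Subalgebra K (Module.End K (MvPolynomial σ K)) := Algebra.adjoin K (Set.range D)
  haveI : IsMulCommutative S := Algebra.isMulCommutative_adjoin K (by
    rintro _ ⟨i, rfl⟩ _ ⟨j, rfl⟩
    exact pderiv_comp_comm i j)
  S.val.comp (aeval fun i => (⟨D i, Algebra.subset_adjoin ⟨i, rfl⟩⟩ : S))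

theorem diffOp_X {σ K : Type*} [Field K] (i : σ) :
    diffOp σ K (X i) = (pderiv i).toLinearMap := by
  simp [diffOp]

/-- `Ann(F)`, the ideal of all `P` with `P(∂/∂x_i : i ∈ σ) F = 0`. -/
def annIdeal {σ K : Type*} [Field K] (F : MvPolynomial σ K) : Ideal (MvPolynomial σ K) where
  carrier := {P | diffOp σ K P F = 0}
  zero_mem' := by simp
  add_mem' := by
    intro P Q hP hQ
    simp only [Set.mem_ofPred_eq] at hP hQ ⊢
    simp [hP, hQ]
  smul_mem' := by
    intro P Q hQ
    simp only [Set.mem_ofPred_eq] at hQ ⊢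
    simp [hQ]

open Classical in
/-- The Kirchhoff polynomial `∑_T ∏_{e ∈ E(T)} x_e` of a graph, the sum running over its spanning
trees `T`; each spanning tree is given by its set of edges. -/
def kirchhoffPolynomial {V : Type*} (K : Type*) [Field K] (Γ : SimpleGraph V)
    [Fintype Γ.edgeSet] : MvPolynomial Γ.edgeSet K :=
  ∑ T : Finset Γ.edgeSet with
      (SimpleGraph.fromEdgeSet (Subtype.val '' (T : Set Γ.edgeSet))).IsTree,
    ∏ e ∈ T, X e

/-- The algebra `A_{M(Γ)} = K[x_e : e ∈ E(Γ)] / Ann(F_Γ)` of the graphic matroid of `Γ`. -/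
abbrev graphicAlgebra {V : Type*} (K : Type*) [Field K] (Γ : SimpleGraph V)
    [Fintype Γ.edgeSet] : Type _ :=
  MvPolynomial Γ.edgeSet K ⧸ annIdeal (kirchhoffPolynomial K Γ)

/-- The homogeneous component of degree `k` of `A_{M(Γ)}`: the classes of the homogeneous
polynomials of degree `k`. -/
def graphicComponent {V : Type*} (K : Type*) [Field K] (Γ : SimpleGraph V)
    [Fintype Γ.edgeSet] (k : ℕ) : Submodule K (graphicAlgebra K Γ) :=
  (homogeneousSubmodule Γ.edgeSet K k).map
    (Ideal.Quotient.mkₐ K (annIdeal (kirchhoffPolynomial K Γ))).toLinearMap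

/-- `A` is an Artinian algebra, graded by `A = ⨁_{k=0}^{s} A_k` with `A_s ≠ 0`. -/
structure IsGradedArtinian {K A : Type*} [Field K] [CommRing A] [Algebra K A]
    (𝒜 : ℕ → Submodule K A) (s : ℕ) : Prop where
  isArtinianRing : IsArtinianRing A
  gradedMonoid : SetLike.GradedMonoid 𝒜
  isInternal : DirectSum.IsInternal 𝒜
  top_ne_bot : 𝒜 s ≠ ⊥
  eq_bot_of_lt : ∀ k, s < k → 𝒜 k = ⊥

/-- `L` is a strong Lefschetz element of the graded Artinian algebra `A = ⨁_{k=0}^{s} A_k`: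
it lies in `A_1`, and `×L^{s-2k} : A_k → A_{s-k}` is bijective for all `k ≤ s/2`. -/
def IsStrongLefschetzElement {K A : Type*} [Field K] [CommRing A] [Algebra K A]
    (𝒜 : ℕ → Submodule K A) (L : A) : Prop :=
  ∃ s : ℕ, IsGradedArtinian 𝒜 s ∧ L ∈ 𝒜 1 ∧
    ∀ k : ℕ, 2 * k ≤ s →
      Set.BijOn (fun a : A => L ^ (s - 2 * k) * a) (𝒜 k : Set A) (𝒜 (s - k) : Set A)

/-- The strong Lefschetz property of a graded Artinian algebra. -/
def HasStrongLefschetzProperty {K A : Type*} [Field K] [CommRing A] [Algebra K A]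
    (𝒜 : ℕ → Submodule K A) : Prop :=
  ∃ L : A, IsStrongLefschetzElement 𝒜 L

end

/-! ### Quotients by annihilators of homogeneous polynomials -/

section GradedQuotient

variable {σ K : Type*} [Field K]

/-! Here `F` is homogeneous of degree `s = m + n - 1 ≤ 4`. Put `L = ∑ x_i`. The map `P ↦ (L ^ (s -
2k) * P)(∂) F` sends forms of degree `k` to forms of degree `k`, so by finite dimension its
injectivity yields both injectivity and surjectivity of `×L ^ (s - 2k)` on the quotient
(`isStrongLefschetzElement_of_injective`). The middle degree is trivial, so only `k = 0, 1` remain.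
By Euler's identity, `L(∂) ^ d` sends a form `G` of degree `d` to `d! * G(1, …, 1)`. For `k = 0`
this gives `s!` times the number of spanning trees, which is nonzero. For `k = 1` (so `s ≥ 3`) it
reduces the claim to nonsingularity of the Hessian of `F` at `(1, …, 1)`, whose entries count the
spanning trees through two given edges. These are finitely many integer matrices, inverted
explicitly in `exists_inverse_pairCount`. -/

theorem mem_annIdeal {F P : MvPolynomial σ K} : P ∈ annIdeal F ↔ diffOp σ K P F = 0 := Iff.rfl

theorem diffOp_X_apply (i : σ) (G : MvPolynomial σ K) : diffOp σ K (X i) G = pderiv i G := by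
  rw [diffOp_X]
  rfl

theorem diffOp_isHomogeneous {F P : MvPolynomial σ K} {s k : ℕ} (hF : F.IsHomogeneous s)
    (hP : P.IsHomogeneous k) :
    (diffOp σ K P F).IsHomogeneous (s - k) ∧ (s < k → diffOp σ K P F = 0) := by
  -- Forms of degree `k` are the `k`-th power of the space of linear forms, so one linear factor is
  -- applied at a time.
  rw [← mem_homogeneousSubmodule, ← homogeneousSubmodule_one_pow] at hP
  induction hP using Submodule.pow_induction_on_left' with
  | algebraMap r =>
    rw [AlgHom.commutes, Module.algebraMap_end_apply]
    exact ⟨(homogeneousSubmodule σ K s).smul_mem r hF, fun h => absurd h (Nat.not_lt_zero s)⟩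
  | add x y i _ _ hx hy =>
    rw [map_add, LinearMap.add_apply]
    exact ⟨hx.1.add hy.1, fun h => by rw [hx.2 h, hy.2 h, add_zero]⟩
  | mem_mul m hm i x _ ih =>
    rw [homogeneousSubmodule_one_eq_span_X] at hm
    rw [map_mul, Module.End.mul_apply]
    generalize diffOp σ K x F = G at ih
    induction hm using Submodule.span_induction with
    | zero => simpa using isHomogeneous_zero σ K _
    | add a b _ _ ha hb =>
      rw [map_add, LinearMap.add_apply]
      exact ⟨ha.1.add hb.1, fun h => by rw [ha.2 h, hb.2 h, add_zero]⟩
    | smul r a _ ha =>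
      rw [map_smul, LinearMap.smul_apply]
      exact ⟨(homogeneousSubmodule σ K _).smul_mem r ha.1, fun h => by rw [ha.2 h, smul_zero]⟩
    | mem a ha =>
      obtain ⟨j, rfl⟩ := ha
      rw [diffOp_X_apply]
      refine ⟨?_, fun h => ?_⟩
      · have := ih.1.pderiv (i := j)
        rwa [Nat.sub_sub] at this
      -- Here `s ≤ i`, so the truncated degree `s - i` is `0`: what is left is a constant, killed by
      -- one more derivative.
      · have h0 := ih.1
        rw [Nat.sub_eq_zero_of_le (Nat.lt_succ_iff.mp h), ← totalDegree_zero_iff_isHomogeneous,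
          totalDegree_eq_zero_iff_eq_C] at h0
        rw [h0, pderiv_C]

theorem diffOp_eq_zero_of_lt {F P : MvPolynomial σ K} {s k : ℕ} (hF : F.IsHomogeneous s)
    (hP : P.IsHomogeneous k) (h : s < k) : diffOp σ K P F = 0 :=
  (diffOp_isHomogeneous hF hP).2 h

/-- The annihilator of a homogeneous polynomial is a homogeneous ideal. -/
theorem mem_annIdeal_of_sum_mem {F : MvPolynomial σ K} {s : ℕ} (hF : F.IsHomogeneous s)
    (t : Finset ℕ) (p : ℕ → MvPolynomial σ K) (hp : ∀ k ∈ t, (p k).IsHomogeneous k)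
    (h : ∑ k ∈ t, p k ∈ annIdeal F) (k : ℕ) (hk : k ∈ t) : p k ∈ annIdeal F := by
  rw [mem_annIdeal] at h ⊢
  by_cases hks : s < k
  · exact diffOp_eq_zero_of_lt hF (hp k hk) hks
  rw [map_sum, LinearMap.sum_apply] at h
  -- The terms with index at most `s` land in distinct degrees; those above `s`, where `s - j`
  -- truncates, vanish.
  have h2 := congrArg (homogeneousComponent (s - k)) h
  rw [map_sum, map_zero, Finset.sum_eq_single k] at h2
  · rwa [homogeneousComponent_eq_self (diffOp_isHomogeneous hF (hp k hk)).1] at h2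
  · intro j hj hjk
    by_cases hjs : s < j
    · rw [diffOp_eq_zero_of_lt hF (hp j hj) hjs, map_zero]
    · rw [homogeneousComponent_of_mem (diffOp_isHomogeneous hF (hp j hj)).1, if_neg (by omega)]
  · exact fun h => absurd hk h

/-- The classes modulo `Ann(F)` of the homogeneous polynomials of degree `k`. -/
noncomputable def quotComponent (F : MvPolynomial σ K) (k : ℕ) :
    Submodule K (MvPolynomial σ K ⧸ annIdeal F) :=
  (homogeneousSubmodule σ K k).map (Ideal.Quotient.mkₐ K (annIdeal F)).toLinearMap

theorem mem_quotComponent {F : MvPolynomial σ K} {k : ℕ} {a : MvPolynomial σ K ⧸ annIdeal F} :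
    a ∈ quotComponent F k ↔ ∃ P : MvPolynomial σ K, P.IsHomogeneous k ∧
      Ideal.Quotient.mk (annIdeal F) P = a := Iff.rfl

theorem iSup_quotComponent (F : MvPolynomial σ K) : iSup (quotComponent F) = ⊤ := by
  rw [eq_top_iff]
  rintro a -
  obtain ⟨P, rfl⟩ := Ideal.Quotient.mk_surjective a
  rw [← sum_homogeneousComponent P, map_sum]
  exact Submodule.sum_mem _ fun i _ => Submodule.mem_iSup_of_mem i
    ⟨_, homogeneousComponent_isHomogeneous i P, rfl⟩

theorem iSupIndep_quotComponent {F : MvPolynomial σ K} {s : ℕ} (hF : F.IsHomogeneous s) :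
    iSupIndep (quotComponent F) := by
  classical
  apply iSupIndep_of_dfinsupp_lsum_injective
  rw [injective_iff_map_eq_zero]
  intro x hx
  choose p hp hpx using fun k => mem_quotComponent.mp (x k).2
  rw [DFinsupp.lsum_apply_apply, DFinsupp.sumAddHom_apply, DFinsupp.sum] at hx
  have hx' : Ideal.Quotient.mk (annIdeal F) (∑ k ∈ x.support, p k) = 0 := by
    rw [map_sum, ← hx]
    exact Finset.sum_congr rfl fun k _ => hpx k
  rw [Ideal.Quotient.eq_zero_iff_mem] at hx'
  ext k
  by_cases hk : k ∈ x.support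
  · rw [← hpx k, Ideal.Quotient.eq_zero_iff_mem.mpr
      (mem_annIdeal_of_sum_mem hF _ p (fun j _ => hp j) hx' k hk)]
    rfl
  · rw [DFinsupp.notMem_support_iff.mp hk]
    rfl

theorem quotComponent_eq_bot {F : MvPolynomial σ K} {s k : ℕ} (hF : F.IsHomogeneous s)
    (h : s < k) : quotComponent F k = ⊥ := by
  rw [eq_bot_iff]
  rintro _ ⟨P, hP, rfl⟩
  exact Ideal.Quotient.eq_zero_iff_mem.mpr (diffOp_eq_zero_of_lt hF hP h)

instance quotComponent_gradedMonoid (F : MvPolynomial σ K) :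
    SetLike.GradedMonoid (quotComponent F) where
  one_mem := ⟨1, isHomogeneous_one σ K, map_one (Ideal.Quotient.mk (annIdeal F))⟩
  mul_mem := by
    rintro i j _ _ ⟨P, hP, rfl⟩ ⟨Q, hQ, rfl⟩
    exact ⟨P * Q, IsHomogeneous.mul hP hQ, map_mul (Ideal.Quotient.mk (annIdeal F)) P Q⟩

theorem finite_quotient_annIdeal [Finite σ] {F : MvPolynomial σ K} {s : ℕ}
    (hF : F.IsHomogeneous s) : Module.Finite K (MvPolynomial σ K ⧸ annIdeal F) := by
  rw [Module.finite_def, ← iSup_quotComponent F]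
  have : iSup (quotComponent F) = ⨆ k ∈ Finset.range (s + 1), quotComponent F k := by
    refine le_antisymm (iSup_le fun k => ?_) (iSup₂_le fun k _ => le_iSup _ k)
    by_cases h : s < k
    · rw [quotComponent_eq_bot hF h]
      exact bot_le
    · exact le_iSup₂_of_le k (Finset.mem_range.mpr (by omega)) le_rfl
  rw [this]
  exact Submodule.fg_biSup _ _ fun k _ => (homogeneousSubmodule_fg σ K k).map _

theorem isGradedArtinian_quotComponent [Finite σ] {F : MvPolynomial σ K} {s : ℕ}
    (hF : F.IsHomogeneous s) (hs : quotComponent F s ≠ ⊥) :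
    IsGradedArtinian (quotComponent F) s where
  isArtinianRing := by
    have := finite_quotient_annIdeal hF
    exact IsArtinianRing.of_finite K _
  gradedMonoid := inferInstance
  isInternal := DirectSum.isInternal_submodule_of_iSupIndep_of_iSup_eq_top
    (iSupIndep_quotComponent hF) (iSup_quotComponent F)
  top_ne_bot := hs
  eq_bot_of_lt _ := quotComponent_eq_bot hF

/-- If `P ↦ (L ^ (s - 2 * k) * P)(∂) F` is injective on the homogeneous polynomials of degree `k`
for all `k < s / 2`, then `L` is a strong Lefschetz element of `K[x_i : i ∈ σ] / Ann(F)`. -/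
theorem isStrongLefschetzElement_of_injective [Finite σ] {F L : MvPolynomial σ K} {s : ℕ}
    (hs : 0 < s) (hF : F.IsHomogeneous s) (hL : L.IsHomogeneous 1)
    (h : ∀ k, 2 * k < s → ∀ P : MvPolynomial σ K, P.IsHomogeneous k →
      diffOp σ K (L ^ (s - 2 * k) * P) F = 0 → P = 0) :
    IsStrongLefschetzElement (quotComponent F) (Ideal.Quotient.mk (annIdeal F) L) := by
  have hLpow (j : ℕ) : (L ^ j).IsHomogeneous j := by simpa using hL.pow j
  refine ⟨s, isGradedArtinian_quotComponent hF fun hbot => ?_, ⟨L, hL, rfl⟩, fun k hk => ?_⟩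
  · have hmem : Ideal.Quotient.mk (annIdeal F) (L ^ s) ∈ quotComponent F s := ⟨_, hLpow s, rfl⟩
    rw [hbot, Submodule.mem_bot, Ideal.Quotient.eq_zero_iff_mem, mem_annIdeal] at hmem
    exact one_ne_zero (h 0 (by omega) 1 (isHomogeneous_one σ K) (by simpa using hmem))
  rcases hk.lt_or_eq with hk | hk
  swap
  · rw [hk, Nat.sub_self, show s - k = k by omega]
    simp only [pow_zero, one_mul]
    exact Set.bijOn_id _
  have hdeg {P : MvPolynomial σ K} (hP : P.IsHomogeneous k) :
      (L ^ (s - 2 * k) * P).IsHomogeneous (s - k) := by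
    have := (hLpow (s - 2 * k)).mul hP
    rwa [show s - 2 * k + k = s - k by omega] at this
  have hinj (P : MvPolynomial σ K) (hP : P.IsHomogeneous k)
      (h0 : L ^ (s - 2 * k) * P ∈ annIdeal F) : P = 0 := h k hk P hP h0
  refine ⟨?_, ?_, ?_⟩
  · rintro _ ⟨P, hP, rfl⟩
    exact ⟨_, hdeg hP, by simp⟩
  · rintro _ ⟨P, hP, rfl⟩ _ ⟨Q, hQ, rfl⟩ hPQ
    have h0 : L ^ (s - 2 * k) * (P - Q) ∈ annIdeal F := by
      rw [← Ideal.Quotient.eq_zero_iff_mem, map_mul, map_pow, map_sub, mul_sub, sub_eq_zero]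
      exact hPQ
    rw [sub_eq_zero.mp (hinj _ (IsHomogeneous.sub hP hQ) h0)]
  · rintro _ ⟨Q, hQ, rfl⟩
    have : Module.Finite K (homogeneousSubmodule σ K k) :=
      Module.Finite.iff_fg.mpr (homogeneousSubmodule_fg σ K k)
    -- Solving `φ P = Q(∂) F` gives `L ^ (s - 2 * k) * P ≡ Q` modulo `Ann(F)`.
    let φ : MvPolynomial σ K →ₗ[K] MvPolynomial σ K :=
      (LinearMap.applyₗ F).comp ((diffOp σ K).toLinearMap.comp
        (LinearMap.mulLeft K (L ^ (s - 2 * k))))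
    have hφ : ∀ P ∈ homogeneousSubmodule σ K k, φ P ∈ homogeneousSubmodule σ K k := fun P hP => by
      have := (diffOp_isHomogeneous hF (hdeg hP)).1
      rwa [show s - (s - k) = k by omega] at this
    have hsurj : Function.Surjective (φ.restrict hφ) := by
      rw [← LinearMap.injective_iff_surjective, injective_iff_map_eq_zero]
      intro P hP
      exact Subtype.ext (h k hk P P.2 (congrArg Subtype.val hP))
    have hQF : diffOp σ K Q F ∈ homogeneousSubmodule σ K k := by
      have := (diffOp_isHomogeneous hF hQ).1
      rwa [show s - (s - k) = k by omega] at this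
    obtain ⟨P, hP⟩ := hsurj ⟨_, hQF⟩
    refine ⟨_, ⟨P, P.2, rfl⟩, ?_⟩
    have hP' : diffOp σ K (L ^ (s - 2 * k) * P) F = diffOp σ K Q F := congrArg Subtype.val hP
    have : Ideal.Quotient.mk (annIdeal F) (L ^ (s - 2 * k) * P) = Ideal.Quotient.mk _ Q := by
      rw [Ideal.Quotient.eq, mem_annIdeal, map_sub, LinearMap.sub_apply, hP', sub_self]
    rw [map_mul, map_pow] at this
    exact this

end GradedQuotient

/-! ### Reduction to the Hessian at the all-ones point -/

section SumOfSquarefree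

variable {σ K : Type*} [Field K]

theorem isHomogeneous_sum_prod {s : ℕ} (𝒯 : Finset (Finset σ)) (h𝒯 : ∀ T ∈ 𝒯, T.card = s) :
    (∑ T ∈ 𝒯, ∏ e ∈ T, X e : MvPolynomial σ K).IsHomogeneous s := by
  refine IsHomogeneous.sum _ _ _ fun T hT => ?_
  have := IsHomogeneous.prod T (fun e => (X e : MvPolynomial σ K)) (fun _ => 1)
    fun e _ => isHomogeneous_X K e
  simpa [h𝒯 T hT] using this

theorem pderiv_prod_X [DecidableEq σ] (i : σ) (T : Finset σ) :
    pderiv i (∏ e ∈ T, X e : MvPolynomial σ K) = if i ∈ T then ∏ e ∈ T.erase i, X e else 0 := by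
  have key (S : Finset σ) (hS : i ∉ S) : pderiv i (∏ e ∈ S, X e : MvPolynomial σ K) = 0 := by
    induction S using Finset.induction_on with
    | empty => simp
    | insert a S ha ih =>
      rw [Finset.mem_insert, not_or] at hS
      rw [Finset.prod_insert ha, Derivation.leibniz, ih hS.2, pderiv_X_of_ne (Ne.symm hS.1)]
      simp
  split_ifs with h
  · rw [← Finset.mul_prod_erase T _ h, Derivation.leibniz, key _ (Finset.notMem_erase i T),
      pderiv_X_self]
    simp
  · exact key T h

/-- The number of members of `𝒯` containing both of two distinct elements. -/
def pairCount [DecidableEq σ] (𝒯 : Finset (Finset σ)) (i j : σ) : ℕ :=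
  (𝒯.filter fun T => i ∈ T ∧ j ∈ T.erase i).card

/-- The `erase` in `pairCount` makes the diagonal zero, matching `∂_i² F = 0` for squarefree `F`. -/
theorem eval_one_pderiv_pderiv [DecidableEq σ] (𝒯 : Finset (Finset σ)) (i j : σ) :
    eval 1 (pderiv j (pderiv i (∑ T ∈ 𝒯, ∏ e ∈ T, X e : MvPolynomial σ K))) =
      pairCount 𝒯 i j := by
  rw [pairCount, Finset.card_filter, map_sum, map_sum, map_sum, Nat.cast_sum]
  refine Finset.sum_congr rfl fun T _ => ?_
  rw [pderiv_prod_X]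
  by_cases hi : i ∈ T
  · by_cases hj : j ∈ T.erase i
    · simp only [if_pos hi, pderiv_prod_X, if_pos hj, if_pos (And.intro hi hj)]
      simp
    · simp only [if_pos hi, pderiv_prod_X, if_neg hj, if_neg (fun h : i ∈ T ∧ _ => hj h.2)]
      simp
  · simp [hi]

theorem eval_one_sum_prod (𝒯 : Finset (Finset σ)) :
    eval 1 (∑ T ∈ 𝒯, ∏ e ∈ T, X e : MvPolynomial σ K) = 𝒯.card := by
  simp

variable [Fintype σ]

theorem diffOp_sum_X (G : MvPolynomial σ K) :
    diffOp σ K (∑ i, X i) G = ∑ i, pderiv i G := by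
  simp [map_sum, diffOp_X_apply]

/-- Euler's identity at `(1, …, 1)` reads `∑ ∂_i G = deg G * G`; iterating it produces the
factorial. -/
theorem diffOp_sum_X_pow {G : MvPolynomial σ K} {k : ℕ} (hG : G.IsHomogeneous k) :
    diffOp σ K ((∑ i, X i) ^ k) G = C ((k.factorial : K) * eval 1 G) := by
  induction k generalizing G with
  | zero =>
    rw [← totalDegree_zero_iff_isHomogeneous, totalDegree_eq_zero_iff_eq_C] at hG
    rw [hG]
    simp
  | succ k ih =>
    rw [pow_succ, map_mul, Module.End.mul_apply, diffOp_sum_X,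
      ih (IsHomogeneous.sum _ _ _ fun i _ => hG.pderiv)]
    have := congrArg (eval 1) hG.sum_X_mul_pderiv
    simp only [map_sum, map_mul, eval_X, Pi.one_apply, one_mul, nsmul_eq_mul, map_natCast] at this
    rw [map_sum, this, Nat.factorial_succ]
    push_cast
    rw [← mul_assoc, mul_comm (k.factorial : K)]

theorem exists_eq_sum_of_isHomogeneous_one {P : MvPolynomial σ K} (hP : P.IsHomogeneous 1) :
    ∃ v : σ → K, P = ∑ i, v i • X i := by
  rw [← mem_homogeneousSubmodule, homogeneousSubmodule_one_eq_span_X,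
    Submodule.mem_span_range_iff_exists_fun] at hP
  obtain ⟨v, hv⟩ := hP
  exact ⟨v, hv.symm⟩

/-- In socle degree at most four, the strong Lefschetz property of the sum of the variables follows
from the nonsingularity of the matrix of pair counts. -/
theorem isStrongLefschetzElement_sum_prod [CharZero K] [DecidableEq σ] {s : ℕ} (hs : 0 < s)
    (hs4 : s ≤ 4) (𝒯 : Finset (Finset σ)) (h𝒯 : ∀ T ∈ 𝒯, T.card = s) (hne : 𝒯.Nonempty)
    (hH : 3 ≤ s → ∀ v : σ → K, (∀ j, ∑ i, v i * pairCount 𝒯 i j = 0) → v = 0) :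
    IsStrongLefschetzElement (quotComponent (∑ T ∈ 𝒯, ∏ e ∈ T, X e : MvPolynomial σ K))
      (Ideal.Quotient.mk _ (∑ i, X i)) := by
  have hF := isHomogeneous_sum_prod (K := K) 𝒯 h𝒯
  refine isStrongLefschetzElement_of_injective hs hF
    (IsHomogeneous.sum _ _ _ fun i _ => isHomogeneous_X K i) fun k hk P hP h0 => ?_
  obtain rfl | rfl : k = 0 ∨ k = 1 := by omega
  · rw [← totalDegree_zero_iff_isHomogeneous, totalDegree_eq_zero_iff_eq_C] at hP
    generalize coeff 0 P = c at hP
    subst hP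
    rw [mul_comm, map_mul, Module.End.mul_apply, Nat.mul_zero, Nat.sub_zero, diffOp_sum_X_pow hF,
      eval_one_sum_prod, ← algebraMap_eq, AlgHom.commutes, Module.algebraMap_end_apply,
      algebraMap_eq, smul_eq_C_mul, ← C_mul, C_eq_zero] at h0
    have : ((s.factorial : K) * 𝒯.card) ≠ 0 :=
      mul_ne_zero (Nat.cast_ne_zero.mpr s.factorial_ne_zero)
        (Nat.cast_ne_zero.mpr (Finset.card_pos.mpr hne).ne')
    rw [(mul_eq_zero.mp h0).resolve_right this, C_0]
  · obtain ⟨v, rfl⟩ := exists_eq_sum_of_isHomogeneous_one hP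
    suffices v = 0 by simp [this]
    refine hH (by omega) v fun j => ?_
    -- The extra factor `X j` lowers the degree to `s - 2`, so that the power of `∑ X i` evaluates
    -- row `j` of the Hessian against `v`.
    have h1 : diffOp σ K ((∑ i, X i) ^ (s - 2) * (X j * ∑ i, v i • X i))
        (∑ T ∈ 𝒯, ∏ e ∈ T, X e) = 0 := by
      rw [mul_left_comm, map_mul, Module.End.mul_apply, h0, map_zero]
    rw [map_mul, Module.End.mul_apply, diffOp_sum_X_pow] at h1
    · rw [C_eq_zero] at h1
      have h2 := (mul_eq_zero.mp h1).resolve_left (Nat.cast_ne_zero.mpr (s - 2).factorial_ne_zero)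
      rw [← h2]
      rw [map_mul, Module.End.mul_apply, diffOp_X_apply, map_sum (diffOp σ K),
        LinearMap.sum_apply, map_sum (pderiv j), map_sum (eval (1 : σ → K))]
      simp only [map_smul, LinearMap.smul_apply, diffOp_X_apply, Derivation.map_smul, smul_eval]
      refine Finset.sum_congr rfl fun i _ => ?_
      rw [← eval_one_pderiv_pderiv]
    · have := (diffOp_isHomogeneous hF ((isHomogeneous_X K j).mul hP)).1
      simpa using this

end SumOfSquarefree

/-! ### Spanning trees of complete bipartite graphs in decidable form -/

section BipartiteTrees

/-- For the converse, colour the vertices by reachability from `u`. Quantifying over colourings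
makes connectedness checkable by finite enumeration. -/
theorem connected_iff_forall_coloring {V : Type*} [Nonempty V] (G : SimpleGraph V) :
    G.Connected ↔ ∀ c : V → Bool, (∀ u v, G.Adj u v → c u = c v) → ∀ u v, c u = c v := by
  classical
  constructor
  · intro h c hc u v
    obtain ⟨w⟩ := h.preconnected u v
    induction w with
    | nil => rfl
    | cons hadj _ ih => exact (hc _ _ hadj).trans ih
  · intro h
    refine (SimpleGraph.connected_iff G).mpr ⟨fun u v => ?_, inferInstance⟩
    have := h (fun w => decide (G.Reachable u w)) (fun a b hab => by
      simp only [decide_eq_decide]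
      exact ⟨fun r => r.trans hab.reachable, fun r => r.trans hab.symm.reachable⟩) u v
    simp only [decide_eq_decide] at this
    exact this.mp (SimpleGraph.Reachable.refl u)

variable {m n : ℕ}

/-- The edges of `K_{m,n}` are the pairs consisting of a left and a right vertex. -/
noncomputable def bipartiteEdgeEquiv (m n : ℕ) :
    Fin m × Fin n ≃ (completeBipartiteGraph (Fin m) (Fin n)).edgeSet :=
  Equiv.ofBijective (fun a => ⟨s(Sum.inl a.1, Sum.inr a.2), by simp [completeBipartiteGraph]⟩) <| by
    constructor
    · rintro ⟨i, j⟩ ⟨i', j'⟩ h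
      simpa using congrArg Subtype.val h
    · rintro ⟨e, he⟩
      induction e using Sym2.ind with
      | _ u v =>
        rcases u with i | j <;> rcases v with i' | j'
        · simp [completeBipartiteGraph] at he
        · exact ⟨(i, j'), rfl⟩
        · exact ⟨(i', j), Subtype.ext Sym2.eq_swap⟩
        · simp [completeBipartiteGraph] at he

/-- The edge sets of the spanning trees of `K_{m,n}`, as sets of pairs. -/
def bipartiteTrees (m n : ℕ) : Finset (Finset (Fin m × Fin n)) :=
  (Finset.univ.powersetCard (m + n - 1)).filter fun T =>
    ∀ (f : Fin m → Bool) (g : Fin n → Bool), (∀ a ∈ T, f a.1 = g a.2) → ∀ i j, f i = g j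

/-- A tree is a connected graph with one edge fewer than vertices. A colouring splits into `f` and
`g` on the two sides; since both are nonempty, agreement across the sides forces it to be constant.
-/
theorem isTree_iff_mem_bipartiteTrees (hm : 1 ≤ m) (hn : 1 ≤ n) (T : Finset (Fin m × Fin n)) :
    (SimpleGraph.fromEdgeSet (Subtype.val ''
      ((T.map (bipartiteEdgeEquiv m n).toEmbedding : Finset _) : Set
        (completeBipartiteGraph (Fin m) (Fin n)).edgeSet))).IsTree ↔ T ∈ bipartiteTrees m n := by
  have : NeZero m := ⟨by omega⟩
  have : NeZero n := ⟨by omega⟩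
  set E : Set (Sym2 (Fin m ⊕ Fin n)) := Subtype.val ''
    ((T.map (bipartiteEdgeEquiv m n).toEmbedding : Finset _) : Set
        (completeBipartiteGraph (Fin m) (Fin n)).edgeSet) with hE
  have hmem (e : Sym2 (Fin m ⊕ Fin n)) : e ∈ E ↔ ∃ a ∈ T, s(Sum.inl a.1, Sum.inr a.2) = e := by
    simp only [hE, Finset.coe_map, Set.image_image, Set.mem_image, Finset.mem_coe]
    rfl
  have hedge : (SimpleGraph.fromEdgeSet E).edgeSet = E := by
    rw [SimpleGraph.edgeSet_fromEdgeSet, sdiff_eq_left, Set.disjoint_left]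
    intro e he
    obtain ⟨a, -, rfl⟩ := (hmem e).mp he
    simp
  have hcard : Nat.card (SimpleGraph.fromEdgeSet E).edgeSet = T.card := by
    rw [hedge, hE, Nat.card_coe_set_eq, Set.ncard_image_of_injective _ Subtype.val_injective,
      Set.ncard_coe_finset, Finset.card_map]
  have hadj (c : Fin m ⊕ Fin n → Bool) :
      (∀ u v, (SimpleGraph.fromEdgeSet E).Adj u v → c u = c v) ↔
        ∀ a ∈ T, c (Sum.inl a.1) = c (Sum.inr a.2) := by
    constructor
    · intro h a ha
      exact h _ _ ((SimpleGraph.fromEdgeSet_adj E).mpr ⟨(hmem _).mpr ⟨a, ha, rfl⟩, by simp⟩)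
    · intro h u v huv
      obtain ⟨a, ha, hae⟩ := (hmem _).mp ((SimpleGraph.fromEdgeSet_adj E).mp huv).1
      rcases Sym2.eq_iff.mp hae with ⟨rfl, rfl⟩ | ⟨rfl, rfl⟩
      · exact h a ha
      · exact (h a ha).symm
  rw [SimpleGraph.isTree_iff_connected_and_card, hcard, connected_iff_forall_coloring,
    bipartiteTrees, Finset.mem_filter, Finset.mem_powersetCard, and_comm]
  refine and_congr ?_ ?_
  · simp only [Nat.card_eq_fintype_card, Fintype.card_sum, Fintype.card_fin, Finset.subset_univ,
      true_and]
    omega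
  · simp only [hadj]
    constructor
    · intro h f g hfg i j
      exact h (Sum.elim f g) hfg (Sum.inl i) (Sum.inr j)
    · intro h c hc
      have h' := h (fun i => c (Sum.inl i)) (fun j => c (Sum.inr j)) hc
      have h0 : ∀ u, c u = c (Sum.inl 0) := by
        rintro (i | j)
        · exact (h' i 0).trans (h' 0 0).symm
        · exact (h' 0 j).symm
      exact fun u v => (h0 u).trans (h0 v).symm

theorem pairCount_map {α β : Type*} [DecidableEq α] [DecidableEq β] (φ : α ≃ β)
    (𝒯 : Finset (Finset α)) (a b : α) :
    pairCount (𝒯.map (Finset.mapEmbedding φ.toEmbedding).toEmbedding) (φ a) (φ b) =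
      pairCount 𝒯 a b := by
  rw [pairCount, pairCount, Finset.filter_map, Finset.card_map]
  congr 1
  refine Finset.filter_congr fun T _ => ?_
  simp

open Classical in
-- In the unfolded definition the summation index has type `Set Γ.edgeSet` and runs over coerced
-- finsets; the injective coercion matches the two sums.
theorem kirchhoffPolynomial_eq_sum {V : Type*} (K : Type*) [Field K] (Γ : SimpleGraph V)
    [Fintype Γ.edgeSet] :
    kirchhoffPolynomial K Γ = ∑ T ∈ Finset.univ.filter (fun T : Finset Γ.edgeSet =>
      (SimpleGraph.fromEdgeSet (Subtype.val '' (T : Set Γ.edgeSet))).IsTree),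
        ∏ e ∈ T, (X e : MvPolynomial Γ.edgeSet K) := by
  unfold kirchhoffPolynomial
  symm
  refine Finset.sum_nbij (fun T : Finset Γ.edgeSet => (T : Set Γ.edgeSet)) ?_ ?_ ?_ ?_
  · intro T hT
    have h := (Finset.mem_filter.mp hT).2
    simpa [Finset.bind_def, Finset.mem_sup, Finset.pure_def] using h
  · exact Finset.coe_injective.injOn
  · intro S hS
    simp only [Finset.bind_def, Finset.pure_def, Finset.coe_filter, Finset.mem_sup,
      Finset.mem_univ, Finset.mem_singleton, true_and, Set.mem_ofPred_eq] at hS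
    obtain ⟨⟨T, rfl⟩, hT⟩ := hS
    exact ⟨T, by simpa using hT, rfl⟩
  · intro T _
    simp

theorem kirchhoffPolynomial_completeBipartiteGraph (K : Type*) [Field K] (hm : 1 ≤ m) (hn : 1 ≤ n)
    [Fintype (completeBipartiteGraph (Fin m) (Fin n)).edgeSet] :
    kirchhoffPolynomial K (completeBipartiteGraph (Fin m) (Fin n)) =
      ∑ T ∈ (bipartiteTrees m n).map
        (Finset.mapEmbedding (bipartiteEdgeEquiv m n).toEmbedding).toEmbedding,
        ∏ e ∈ T, (X e : MvPolynomial (completeBipartiteGraph (Fin m) (Fin n)).edgeSet K) := by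
  classical
  rw [kirchhoffPolynomial_eq_sum]
  congr 1
  refine Finset.ext fun T => ?_
  obtain ⟨T, rfl⟩ := (Equiv.finsetCongr (bipartiteEdgeEquiv m n)).surjective T
  rw [Finset.mem_filter, Equiv.finsetCongr_apply, isTree_iff_mem_bipartiteTrees hm hn]
  simp

/-- An integer certificate `N * B = d • 1` with `d ≠ 0` stays valid in every field of characteristic
zero. -/
theorem eq_zero_of_forall_sum_mul_eq_zero {K ι : Type*} [Field K] [CharZero K] [Fintype ι]
    [DecidableEq ι] (N : ι → ι → ℕ) (B : ι → ι → ℤ) (d : ℤ) (hd : d ≠ 0)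
    (hB : ∀ i k, ∑ j, (N i j : ℤ) * B j k = if i = k then d else 0) (v : ι → K)
    (hv : ∀ j, ∑ i, v i * N i j = 0) : v = 0 := by
  funext k
  have h1 : ∑ j, (∑ i, v i * N i j) * (B j k : K) = v k * d := by
    simp_rw [Finset.sum_mul]
    rw [Finset.sum_comm]
    have (i : ι) : ∑ j, v i * N i j * (B j k : K) = v i * if i = k then (d : K) else 0 := by
      have := congrArg (Int.cast : ℤ → K) (hB i k)
      push_cast at this
      simp_rw [mul_assoc]
      rw [← Finset.mul_sum, this]
    simp [this]
  simp only [hv, zero_mul, Finset.sum_const_zero] at h1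
  exact (mul_eq_zero.mp h1.symm).resolve_right (Int.cast_ne_zero.mpr hd)

theorem isStrongLefschetzElement_completeBipartiteGraph (K : Type*) [Field K] [CharZero K]
    (hm : 1 ≤ m) (hn : 1 ≤ n) (hmn : m + n ≤ 5)
    [Fintype (completeBipartiteGraph (Fin m) (Fin n)).edgeSet]
    (hne : (bipartiteTrees m n).Nonempty)
    (hB : 3 ≤ m + n - 1 → ∃ B : Fin m × Fin n → Fin m × Fin n → ℤ, ∃ d : ℤ, d ≠ 0 ∧
      ∀ i k, ∑ j, (pairCount (bipartiteTrees m n) i j : ℤ) * B j k = if i = k then d else 0) :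
    IsStrongLefschetzElement (graphicComponent K (completeBipartiteGraph (Fin m) (Fin n)))
      (Ideal.Quotient.mk _ (∑ e, X e)) := by
  classical
  change IsStrongLefschetzElement
    (quotComponent (kirchhoffPolynomial K (completeBipartiteGraph (Fin m) (Fin n)))) _
  rw [kirchhoffPolynomial_completeBipartiteGraph K hm hn]
  refine isStrongLefschetzElement_sum_prod (s := m + n - 1) (by omega) (by omega) _ ?_
    (hne.map) ?_
  · intro T hT
    obtain ⟨S, hS, rfl⟩ := Finset.mem_map.mp hT
    simpa using (Finset.mem_powersetCard.mp (Finset.mem_filter.mp hS).1).2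
  · intro hs v hv
    obtain ⟨B, d, hd, hBd⟩ := hB hs
    have h0 := eq_zero_of_forall_sum_mul_eq_zero _ B d hd hBd
      (fun a => v (bipartiteEdgeEquiv m n a)) fun b => by
        rw [← hv (bipartiteEdgeEquiv m n b), ← (bipartiteEdgeEquiv m n).sum_comp]
        exact Finset.sum_congr rfl fun a _ => by rw [pairCount_map]
    funext e
    obtain ⟨a, rfl⟩ := (bipartiteEdgeEquiv m n).surjective e
    exact congrFun h0 a

end BipartiteTrees

/-! ### Explicit pair-count matrices and their inverses -/

section SmallCases

theorem bipartiteTrees_nonempty {m n : ℕ} (hm : 1 ≤ m) (hn : 1 ≤ n) (hmn : m + n ≤ 5) :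
    (bipartiteTrees m n).Nonempty := by
  have hm4 : m ≤ 4 := by omega
  have hn4 : n ≤ 4 := by omega
  interval_cases m <;> interval_cases n <;> first | omega | decide +kernel

theorem pairCount_two_three (a b : Fin 2 × Fin 3) :
    pairCount (bipartiteTrees 2 3) a b = if a = b then 0 else if a.2 = b.2 then 4 else 5 := by
  decide +kernel +revert

theorem pairCount_three_two (a b : Fin 3 × Fin 2) :
    pairCount (bipartiteTrees 3 2) a b = if a = b then 0 else if a.1 = b.1 then 4 else 5 := by
  decide +kernel +revert

theorem pairCount_two_two (a b : Fin 2 × Fin 2) :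
    pairCount (bipartiteTrees 2 2) a b = if a = b then 0 else 2 := by
  decide +kernel +revert

theorem pairCount_star_right {n : ℕ} (hn3 : 3 ≤ n) (hn4 : n ≤ 4) (a b : Fin 1 × Fin n) :
    pairCount (bipartiteTrees 1 n) a b = if a = b then 0 else 1 := by
  interval_cases n <;> decide +kernel +revert

theorem pairCount_star_left {m : ℕ} (hm3 : 3 ≤ m) (hm4 : m ≤ 4) (a b : Fin m × Fin 1) :
    pairCount (bipartiteTrees m 1) a b = if a = b then 0 else 1 := by
  interval_cases m <;> decide +kernel +revert

theorem exists_inverse_pairCount {m n : ℕ} (hm : 1 ≤ m) (hn : 1 ≤ n) (hmn : m + n ≤ 5)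
    (h3 : 3 ≤ m + n - 1) :
    ∃ B : Fin m × Fin n → Fin m × Fin n → ℤ, ∃ d : ℤ, d ≠ 0 ∧
      ∀ i k, ∑ j, (pairCount (bipartiteTrees m n) i j : ℤ) * B j k = if i = k then d else 0 := by
  obtain rfl | rfl | ⟨rfl, rfl⟩ | ⟨rfl, rfl⟩ | ⟨rfl, rfl⟩ : m = 1 ∨ n = 1 ∨ (m = 2 ∧ n = 2) ∨
      (m = 2 ∧ n = 3) ∨ (m = 3 ∧ n = 2) := by omega
  -- With `J` the all-ones matrix, a star has `N = J - 1`, and `(J - 1) * (J - (n - 1)) = n - 1`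
  -- since `J² = n * J`.
  · refine ⟨fun j k => if j = k then 2 - n else 1, n - 1, by omega, ?_⟩
    simp_rw [pairCount_star_right (show 3 ≤ n by omega) (show n ≤ 4 by omega)]
    obtain rfl | rfl : n = 3 ∨ n = 4 := by omega
    all_goals decide +kernel
  · refine ⟨fun j k => if j = k then 2 - m else 1, m - 1, by omega, ?_⟩
    simp_rw [pairCount_star_left (show 3 ≤ m by omega) (show m ≤ 4 by omega)]
    obtain rfl | rfl : m = 3 ∨ m = 4 := by omega
    all_goals decide +kernel
  -- `N = 2 * (J - 1)` and `B = J - 3`, with `J² = 4 * J`.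
  · refine ⟨fun j k => if j = k then -2 else 1, 6, by decide, ?_⟩
    simp_rw [pairCount_two_two]
    decide +kernel
  -- Let `S` swap the two edges at each vertex of the three-element side. Then `N = 5J - 5 - S` has
  -- eigenvalues `24, -6, -4`, and `B = 5J - 30 + 6S` has `6, -24, -36` on the same eigenspaces;
  -- each product is `144`.
  · refine ⟨fun j k => if j = k then -25 else if j.2 = k.2 then 11 else 5, 144, by decide, ?_⟩
    simp_rw [pairCount_two_three]
    decide +kernel
  · refine ⟨fun j k => if j = k then -25 else if j.1 = k.1 then 11 else 5, 144, by decide, ?_⟩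
    simp_rw [pairCount_three_two]
    decide +kernel

end SmallCases

theorem mainTheorem6 (K : Type*) [Field K] [CharZero K] (m n : ℕ) (hm : 1 ≤ m) (hn : 1 ≤ n)
    (hmn : m + n ≤ 5) [Fintype (completeBipartiteGraph (Fin m) (Fin n)).edgeSet] :
    HasStrongLefschetzProperty (graphicComponent K (completeBipartiteGraph (Fin m) (Fin n))) ∧
      IsStrongLefschetzElement (graphicComponent K (completeBipartiteGraph (Fin m) (Fin n)))
        (Ideal.Quotient.mk _ (∑ e, MvPolynomial.X e)) := by
  have h := isStrongLefschetzElement_completeBipartiteGraph K hm hn hmn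
    (bipartiteTrees_nonempty hm hn hmn) (exists_inverse_pairCount hm hn hmn)
  exact ⟨⟨_, h⟩, h⟩
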